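/- Let $M=\mathbb H^3/\Gamma$, $\Gamma\subset \mathrm{PSL}_2(\mathbb C)$, be a complete orientable hyperbolic 3-manifold of finite volume with at least one cusp. For each cusp choose an essential (oriented) simple closed curve on its torus cross-section, the meridian, and choose the horospherical cross-section on which the meridian has length $1$. Let $H_P\subset\mathbb H^3$ be the horosphere centred at $P$ that is a lift of such a cross-section; it carries a complex coordinate, unique up to translation, in which the meridional translation is $+1$. For two such horospheres $H_P\neq H_Q$ let $\gamma(H_P,H_Q)$ be the shortest geodesic arc between them (a point if they touch). If it has length $d$, and the meridional direction of $H_P$, parallel translated along $\gamma(H_P,H_Q)$, has to be rotated by the angle $\theta$ in $H_Q$ to become the meridional direction of $H_Q$, then the intercusp parameter is $w(H_P,H_Q)=e^{-(d+i\theta)}$. For $H_Q\ne H_P\ne H_R$ the translation parameter $u(H_Q,H_P,H_R)$ is the complex number that describes the translation of $H_P$ taking the end point of $\gamma(H_Q,H_P)$ on $H_P$ to the end point of $\gamma(H_P,H_R)$ on $H_P$. An intercusp arc of $M$ is the image of some $\gamma(H_P,H_Q)$, and a cusp arc of $M$ is the image of the line segment in some $H_P$ joining the end points on $H_P$ of some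 $\gamma(H_Q,H_P)$ and $\gamma(H_P,H_R)$. Let $X\subset M$ be the union of finitely many intercusp arcs and cusp arcs, where arcs may have been bent (replaced by arcs that are homotopic to them with end points fixed), so that the arcs are embedded (except that end points may coincide) and any two of them meet at most in their end points. If two ends of lifted arcs on different horospheres are the same point (which can happen only where two horospheres touch), the corresponding intercusp arc of length zero is required to be one of the intercusp arcs. Suppose that $\pi_1(X)\to\pi_1(M)$ is surjective, in the sense that the preimage of $X$ in $\mathbb H^3$ is connected. Then the intercusp parameters of the intercusp arcs and the translation parameters of the cusp arcs generate over $\mathbb Q$ the invariant trace field $k(M)$, that is, the field generated over $\mathbb Q$ by the traces of the elements of $\Gamma^2=\langle \gamma^2\mid\gamma\in\Gamma\rangle$. -/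

import Mathlib

open scoped MatrixGroups

noncomputable section

namespace HypThree

/-! ### Upper half space and the action of `PSL(2, ℂ)` -/

/-- Hyperbolic 3-space in the upper half space model `ℂ × ℝ_{>0}`. -/
abbrev H3 : Type := {p : ℂ × ℝ // 0 < p.2}

/-- The (complex) horizontal coordinate of a point of hyperbolic space. -/
def H3.z (x : H3) : ℂ := x.1.1

/-- The height of a point of hyperbolic space. -/
def H3.t (x : H3) : ℝ := x.1.2

/-- The point of hyperbolic space with given horizontal coordinate and height. -/
def H3.mk (z : ℂ) (t : ℝ) (ht : 0 < t) : H3 := ⟨(z, t), ht⟩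

theorem H3.t_pos (x : H3) : 0 < x.t := x.2

theorem H3.ext' {x y : H3} (hz : x.z = y.z) (ht : x.t = y.t) : x = y :=
  Subtype.ext (Prod.ext hz ht)

/-- The denominator `|c z + d|² + |c|² t²` of the Poincaré extension. -/
def den (A : SL(2, ℂ)) (x : H3) : ℝ :=
  Complex.normSq (A 1 0 * x.z + A 1 1) + Complex.normSq (A 1 0) * x.t ^ 2

theorem den_pos (A : SL(2, ℂ)) (x : H3) : 0 < den A x := by
  unfold den
  have ht := x.t_pos
  by_cases hc : A 1 0 = 0
  · have hdet := A.det_coe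
    rw [Matrix.det_fin_two] at hdet
    have hd : A 1 1 ≠ 0 := by
      intro hd
      simp [hc, hd] at hdet
    have := Complex.normSq_pos.2 hd
    simpa [hc] using this
  · have h1 := Complex.normSq_pos.2 hc
    have h2 := Complex.normSq_nonneg (A 1 0 * x.z + A 1 1)
    positivity

/-- The numerator of the horizontal coordinate of the Poincaré extension. -/
def num (A : SL(2, ℂ)) (x : H3) : ℂ :=
  (A 0 0 * x.z + A 0 1) * star (A 1 0 * x.z + A 1 1) + A 0 0 * star (A 1 0) * (x.t : ℂ) ^ 2

/-- The Poincaré extension to hyperbolic space of a Möbius transformation. -/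
def act (A : SL(2, ℂ)) (x : H3) : H3 :=
  H3.mk (num A x / (den A x : ℂ)) (x.t / den A x) (div_pos x.t_pos (den_pos A x))

theorem den_ofReal (A : SL(2, ℂ)) (x : H3) : (den A x : ℂ) =
    (A 1 0 * x.z + A 1 1) * star (A 1 0 * x.z + A 1 1)
      + A 1 0 * star (A 1 0) * (x.t : ℂ) ^ 2 := by
  unfold den
  push_cast
  rw [← Complex.mul_conj, ← Complex.mul_conj]
  rfl

theorem den_mul (A B : SL(2, ℂ)) (x : H3) :
    (den A (act B x) : ℂ) * den B x = den (A * B) x ∧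
    num A (act B x) * den B x = num (A * B) x := by
  have hD : (den B x : ℂ) ≠ 0 := by exact_mod_cast (den_pos B x).ne'
  have hz : (act B x).z = num B x / (den B x : ℂ) := rfl
  have ht : (act B x).t = x.t / den B x := rfl
  have hdet := B.det_coe
  rw [Matrix.det_fin_two] at hdet
  have hdet' : star (B 0 0) * star (B 1 1) - star (B 0 1) * star (B 1 0) = 1 := by
    have := congrArg star hdet
    simpa [mul_comm] using this
  have hsD : star (den B x : ℂ) = (den B x : ℂ) := Complex.conj_ofReal _
  have hst : star (x.t : ℂ) = (x.t : ℂ) := Complex.conj_ofReal _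
  have hm : (B 0 0 * B 1 1 - B 0 1 * B 1 0) *
      (star (B 0 0) * star (B 1 1) - star (B 0 1) * star (B 1 0)) = 1 := by
    rw [hdet, hdet', one_mul]
  have e := den_ofReal B x
  have hN : num B x = (B 0 0 * x.z + B 0 1) * star (B 1 0 * x.z + B 1 1)
    + B 0 0 * star (B 1 0) * (x.t : ℂ) ^ 2 := rfl
  constructor
  · rw [den_ofReal A, den_ofReal (A * B), hz, ht]
    push_cast
    have : ((A 1 0 * num B x + A 1 1 * den B x) *
        (star (A 1 0) * star (num B x) + star (A 1 1) * den B x) +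
        A 1 0 * star (A 1 0) * (x.t : ℂ) ^ 2) =
        (((A * B) 1 0 * x.z + (A * B) 1 1) * star ((A * B) 1 0 * x.z + (A * B) 1 1) +
          (A * B) 1 0 * star ((A * B) 1 0) * (x.t : ℂ) ^ 2) * den B x := by
      rw [e, hN]
      simp only [Matrix.SpecialLinearGroup.coe_mul, Matrix.mul_apply, Fin.sum_univ_two,
        star_add, star_mul', star_star, star_pow, hst]
      linear_combination (-(A 1 0 * star (A 1 0) * (x.t : ℂ) ^ 2)) * hm
    simp only [star_add, star_mul', star_div₀, hsD] at this ⊢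
    field_simp
    linear_combination this
  · rw [num, num, hz, ht]
    push_cast
    have : ((A 0 0 * num B x + A 0 1 * den B x) *
        (star (A 1 0) * star (num B x) + star (A 1 1) * den B x) +
        A 0 0 * star (A 1 0) * (x.t : ℂ) ^ 2) =
        (((A * B) 0 0 * x.z + (A * B) 0 1) * star ((A * B) 1 0 * x.z + (A * B) 1 1) +
          (A * B) 0 0 * star ((A * B) 1 0) * (x.t : ℂ) ^ 2) * den B x := by
      rw [e, hN]
      simp only [Matrix.SpecialLinearGroup.coe_mul, Matrix.mul_apply, Fin.sum_univ_two,
        star_add, star_mul', star_star, star_pow, hst]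
      linear_combination (-(A 0 0 * star (A 1 0) * (x.t : ℂ) ^ 2)) * hm
    simp only [star_add, star_mul', star_div₀, hsD] at this ⊢
    field_simp
    linear_combination this

instance instMulActionSL : MulAction SL(2, ℂ) H3 where
  smul := act
  one_smul x := by
    apply H3.ext'
    · change num 1 x / (den 1 x : ℂ) = x.z
      simp [num, den]
    · change x.t / den 1 x = x.t
      simp [den]
  mul_smul A B x := by
    obtain ⟨h1, h2⟩ := den_mul A B x
    have hD : (den B x : ℂ) ≠ 0 := by exact_mod_cast (den_pos B x).ne'
    have hA : (den A (act B x) : ℂ) ≠ 0 := by exact_mod_cast (den_pos A _).ne'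
    have h1' : den A (act B x) * den B x = den (A * B) x := by exact_mod_cast h1
    apply H3.ext'
    · change num (A * B) x / (den (A * B) x : ℂ) =
        num A (act B x) / (den A (act B x) : ℂ)
      rw [← h1, ← h2]
      field_simp
    · change x.t / den (A * B) x = (x.t / den B x) / den A (act B x)
      rw [← h1', div_div, mul_comm]

theorem center_cases {A : SL(2, ℂ)} (hA : A ∈ Subgroup.center SL(2, ℂ)) :
    A 0 1 = 0 ∧ A 1 0 = 0 ∧ A 1 1 = A 0 0 ∧ A 0 0 * A 0 0 = 1 := by
  obtain ⟨r, hr, h⟩ := Matrix.SpecialLinearGroup.mem_center_iff.1 hA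
  have h' : ∀ i j, A i j = Matrix.scalar (Fin 2) r i j := fun i j => by rw [h]
  refine ⟨by simp [h'], by simp [h'], by simp [h'], ?_⟩
  simpa [h', sq] using hr

/-- The action of `PSL(2, ℂ)` on hyperbolic space by orientation preserving isometries. -/
instance instMulActionH3 : MulAction PSL(2, ℂ) H3 :=
  MulAction.compHom H3 <| QuotientGroup.lift (Subgroup.center SL(2, ℂ))
    (MulAction.toPermHom SL(2, ℂ) H3) <| by
      intro A hA
      obtain ⟨h1, h2, h3, h4⟩ := center_cases hA
      have hn : Complex.normSq (A 0 0) = 1 := by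
        have := congrArg Complex.normSq h4
        rw [map_mul, map_one] at this
        nlinarith [Complex.normSq_nonneg (A 0 0)]
      refine Equiv.ext fun x => H3.ext' ?_ ?_
      · change num A x / (den A x : ℂ) = x.z
        have : A 0 0 * star (A 0 0) = 1 := by
          have h := Complex.mul_conj (A 0 0)
          rw [hn] at h
          simpa using h
        simp only [num, den, h1, h2, h3]
        simp only [add_zero, zero_mul, zero_add, star_zero, mul_zero, map_zero, hn]
        rw [Complex.ofReal_one, div_one]
        linear_combination x.z * this
      · change x.t / den A x = x.t
        simp [den, h2, h3, hn]

/-- The action of `PSL(2, ℂ)` on the sphere at infinity `ℂ ∪ {∞}` by Möbius transformations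
`z ↦ (a z + b) / (c z + d)`. -/
instance instMulActionSphere : MulAction PSL(2, ℂ) (OnePoint ℂ) :=
  MulAction.compHom (OnePoint ℂ) <| QuotientGroup.lift (Subgroup.center SL(2, ℂ))
    ((MulAction.toPermHom (GL (Fin 2) ℂ) (OnePoint ℂ)).comp
      Matrix.SpecialLinearGroup.toGL) <| by
      intro A hA
      obtain ⟨h1, h2, h3, h4⟩ := center_cases hA
      have h0 : A 0 0 ≠ 0 := by
        intro h
        simp [h] at h4
      refine Equiv.ext fun P => ?_
      change Matrix.SpecialLinearGroup.toGL A • P = P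
      induction P using OnePoint.rec with
      | infty => simp [OnePoint.smul_infty_eq_ite, h2]
      | coe k => simp [OnePoint.smul_some_eq_ite, h1, h2, h3, h0]

theorem mk_smul_H3 (A : SL(2, ℂ)) (x : H3) : ((A : PSL(2, ℂ)) • x) = act A x := rfl

theorem mk_smul_sphere (A : SL(2, ℂ)) (P : OnePoint ℂ) :
    ((A : PSL(2, ℂ)) • P) = Matrix.SpecialLinearGroup.toGL A • P := rfl

/-! ### Hyperbolic 3-manifolds of finite volume -/

/-- The hyperbolic volume measure, `dx dy dt / t³`. -/
def hypVolume : MeasureTheory.Measure H3 :=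
  (MeasureTheory.Measure.comap Subtype.val MeasureTheory.volume).withDensity
    fun x => ENNReal.ofReal (1 / H3.t x ^ 3)

/-- `H3 / Γ` is a complete orientable hyperbolic 3-manifold of finite volume: `Γ` acts freely and
properly discontinuously, with a fundamental domain of finite volume. -/
structure IsFiniteVolumeManifoldGroup (Γ : Subgroup PSL(2, ℂ)) : Prop where
  free : ∀ g ∈ Γ, ∀ x : H3, g • x = x → g = 1
  properlyDiscontinuous : ProperlyDiscontinuousSMul Γ H3
  finiteVolume : ∃ D : Set H3,
    MeasureTheory.IsFundamentalDomain Γ D hypVolume ∧ hypVolume D < ⊤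

/-- The manifold `M = H3 / Γ`. -/
abbrev Manifold (Γ : Subgroup PSL(2, ℂ)) : Type := MulAction.orbitRel.Quotient Γ H3

/-- The covering projection `H3 → M`. -/
def proj (Γ : Subgroup PSL(2, ℂ)) (x : H3) : Manifold Γ :=
  Quotient.mk (MulAction.orbitRel Γ H3) x

/-- The traces (both signs) of the elements of a subset of `PSL(2, ℂ)`. -/
def traces (S : Set PSL(2, ℂ)) : Set ℂ :=
  {x | ∃ A : SL(2, ℂ), (A : PSL(2, ℂ)) ∈ S ∧ x = Matrix.trace (A : Matrix (Fin 2) (Fin 2) ℂ)}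

/-- The invariant trace field: the field generated over `ℚ` by the traces of the subgroup of `Γ`
generated by the squares of the elements of `Γ`. -/
def invariantTraceField (Γ : Subgroup PSL(2, ℂ)) : IntermediateField ℚ ℂ :=
  IntermediateField.adjoin ℚ (traces (Subgroup.closure {h | ∃ g ∈ Γ, h = g ^ 2}))

/-! ### Cusps, meridians and horospheres -/

/-- The matrix of the translation `z ↦ z + 1`. -/
def Tmat : SL(2, ℂ) := ⟨!![1, 1; 0, 1], by simp [Matrix.det_fin_two]⟩

/-- The translation `z ↦ z + 1`. -/
def T : PSL(2, ℂ) := (Tmat : PSL(2, ℂ))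

/-- `g` is parabolic with fixed point `P`: it becomes `z ↦ z + 1` when `P` is suitably moved to
`∞`. -/
def IsParabolicAt (g : PSL(2, ℂ)) (P : OnePoint ℂ) : Prop :=
  ∃ A : PSL(2, ℂ), A • P = OnePoint.infty ∧ A * g * A⁻¹ = T

/-- `P` is the centre of horospheres that are lifts of cusp cross-sections of `H3 / Γ`. -/
def IsCusp (Γ : Subgroup PSL(2, ℂ)) (P : OnePoint ℂ) : Prop :=
  ∃ g ∈ Γ, IsParabolicAt g P

/-- A choice of an (oriented) meridian, that is, of an essential simple closed curve on the torus
cross-section, for every cusp of `H3 / Γ`. In terms of covering transformations: to each centre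
`P` a primitive parabolic element `mer P` of `Γ` fixing `P`, compatibly with the action of `Γ`. -/
structure Meridians (Γ : Subgroup PSL(2, ℂ)) where
  mer : OnePoint ℂ → PSL(2, ℂ)
  mem : ∀ P, IsCusp Γ P → mer P ∈ Γ
  parabolic : ∀ P, IsCusp Γ P → IsParabolicAt (mer P) P
  primitive : ∀ P, IsCusp Γ P → ∀ h ∈ Γ, ∀ n : ℤ, h ^ n = mer P → n = 1 ∨ n = -1
  equivariant : ∀ P, IsCusp Γ P → ∀ g ∈ Γ, mer (g • P) = g * mer P * g⁻¹

variable {Γ : Subgroup PSL(2, ℂ)}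

/-- The isometry `A` positions the centre `P` at `∞` with the meridian acting as `z ↦ z + 1`.
Such an `A` is unique up to composition with a translation `z ↦ z + b`. -/
def Meridians.Positions (m : Meridians Γ) (P : OnePoint ℂ) (A : PSL(2, ℂ)) : Prop :=
  A • P = OnePoint.infty ∧ A * m.mer P * A⁻¹ = T

/-- The horosphere centred at `P` on which the meridian has length `1`: it is the plane `t = 1`
once `P` is at `∞` with the meridian acting as `z ↦ z + 1`. Then `z` is the complex coordinate of
the horosphere, well defined up to translation. -/
def Meridians.horosphere (m : Meridians Γ) (P : OnePoint ℂ) : Set H3 :=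
  {x | ∃ A, m.Positions P A ∧ (A • x).t = 1}

/-- The geodesic of hyperbolic space with distinct ideal end points `P` and `Q`. -/
def geodesic (P Q : OnePoint ℂ) : Set H3 :=
  {x | ∃ A : PSL(2, ℂ), A • P = OnePoint.infty ∧ A • Q = ((0 : ℂ) : OnePoint ℂ) ∧ (A • x).z = 0}

/-- The point in which the horosphere centred at `p.1` meets the geodesic from `p.1` to `p.2`
(a set with one element if `p.1` is a cusp and `p.1 ≠ p.2`). It is the end on the first
horosphere of the shortest arc `γ` between the horospheres centred at `p.1` and `p.2`. -/
def Meridians.foot (m : Meridians Γ) (p : OnePoint ℂ × OnePoint ℂ) : Set H3 :=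
  m.horosphere p.1 ∩ geodesic p.1 p.2

/-! ### Intercusp and translation parameters -/

/-- `δ = d + iθ` is the complex distance from the horosphere `H_P` to the horosphere `H_Q`.

Position `H_P` by `A` as the plane `t = 1` with meridional direction `1`, and `Q` at `0`. The arc
`γ(H_P, H_Q)` is then the vertical segment from `(0, 1)` to the point `y = (0, exp (-d))` of
`H_Q`, a segment of length `d`. Parallel translation along the segment takes the meridional
direction of `H_P` to the horizontal direction `1` at `y`. This direction is expressed in the
complex coordinate of `H_Q`, in which the meridional direction of `H_Q` is `1`, by means of an
isometry `B` positioning `Q`; it has to be rotated by the angle `θ` to become the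
meridional direction of `H_Q`. -/
def Meridians.IsComplexDistance (m : Meridians Γ) (P Q : OnePoint ℂ) (δ : ℂ) : Prop :=
  ∃ A B : PSL(2, ℂ), m.Positions P A ∧ A • Q = ((0 : ℂ) : OnePoint ℂ) ∧ m.Positions Q B ∧
    ((B * A⁻¹) • H3.mk 0 (Real.exp (-δ.re)) (Real.exp_pos _)).t = 1 ∧
    ∃ r : ℝ, 0 < r ∧
      HasDerivAt
        (fun s : ℝ => ((B * A⁻¹) • H3.mk (s : ℂ) (Real.exp (-δ.re)) (Real.exp_pos _)).z)
        (r * Complex.exp (-(δ.im * Complex.I))) 0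

/-- `w` is the intercusp parameter `w(H_P, H_Q) = exp (-δ(H_P, H_Q))`. -/
def Meridians.IsIntercuspParameter (m : Meridians Γ) (P Q : OnePoint ℂ) (w : ℂ) : Prop :=
  ∃ δ : ℂ, m.IsComplexDistance P Q δ ∧ w = Complex.exp (-δ)

/-- `u` is the translation parameter `u(H_Q, H_P, H_R)`: in the complex coordinate of `H_P`, the
translation from the point where `H_P` meets the geodesic `Q P` to the point where it meets the
geodesic `P R`. -/
def Meridians.IsTranslationParameter (m : Meridians Γ) (Q P R : OnePoint ℂ) (u : ℂ) : Prop :=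
  ∃ A : PSL(2, ℂ), m.Positions P A ∧ ∃ x ∈ m.foot (P, Q), ∃ y ∈ m.foot (P, R),
    u = (A • y).z - (A • x).z

/-! ### Intercusp arcs, cusp arcs, and their union -/

/-- (A lift to hyperbolic space of) a possibly bent intercusp arc: an arc with the end points of
the geodesic arc `γ(H_P, H_Q)`. The geodesic arc itself is the unbent case; as hyperbolic space is
simply connected, every such arc is homotopic to it with end points fixed. -/
structure IntercuspArc (m : Meridians Γ) where
  P : OnePoint ℂ
  Q : OnePoint ℂ
  cuspP : IsCusp Γ P
  cuspQ : IsCusp Γ Q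
  ne : P ≠ Q
  path : C(unitInterval, H3)
  source : path 0 ∈ m.foot (P, Q)
  target : path 1 ∈ m.foot (Q, P)

/-- (A lift to hyperbolic space of) a possibly bent cusp arc: an arc with the end points of the
line segment in the horosphere `H_P` from the end of `γ(H_Q, H_P)` to the end of `γ(H_P, H_R)`.
The line segment itself is the unbent case. -/
structure CuspArc (m : Meridians Γ) where
  Q : OnePoint ℂ
  P : OnePoint ℂ
  R : OnePoint ℂ
  cuspQ : IsCusp Γ Q
  cuspP : IsCusp Γ P
  cuspR : IsCusp Γ R
  neQ : P ≠ Q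
  neR : P ≠ R
  path : C(unitInterval, H3)
  source : path 0 ∈ m.foot (P, Q)
  target : path 1 ∈ m.foot (P, R)

variable {m : Meridians Γ} {ι κ : Type*}

/-- The arcs of a collection of intercusp arcs and cusp arcs. -/
def arcs (a : ι → IntercuspArc m) (c : κ → CuspArc m) : ι ⊕ κ → C(unitInterval, H3) :=
  Sum.elim (fun i => (a i).path) (fun j => (c j).path)

/-- The subset `X` of `M = H3 / Γ` that is the union of the images of the arcs. -/
def arcUnion (a : ι → IntercuspArc m) (c : κ → CuspArc m) : Set (Manifold Γ) :=
  ⋃ e, proj Γ '' Set.range (arcs a c e)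

/-- The end points of an arc. -/
def endPoints (γ : C(unitInterval, H3)) : Set H3 := {γ 0, γ 1}

/-- The images of the arcs in `M = H3 / Γ` are embedded, and meet at most in their end points:
if `γ_e(s)` and `γ_f(t)` have the same image in `M`, then either they are the same point of the
same arc, or this point is an end point of both arcs. -/
def AreEmbeddedUpToEnds (a : ι → IntercuspArc m) (c : κ → CuspArc m) : Prop :=
  ∀ e f : ι ⊕ κ, ∀ s t : unitInterval, proj Γ (arcs a c e s) = proj Γ (arcs a c f t) →
    (e = f ∧ s = t) ∨
      (arcs a c e s ∈ endPoints (arcs a c e) ∧ arcs a c f t ∈ endPoints (arcs a c f))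

/-- All pairs `(P, Q)` for which the point of `H_P` on the geodesic `P Q` is an end of a lift of
one of the arcs. -/
def liftedEnds (a : ι → IntercuspArc m) (c : κ → CuspArc m) :
    Set (OnePoint ℂ × OnePoint ℂ) :=
  {p | ∃ g ∈ Γ, (∃ i, p = g • ((a i).P, (a i).Q) ∨ p = g • ((a i).Q, (a i).P)) ∨
    (∃ j, p = g • ((c j).P, (c j).Q) ∨ p = g • ((c j).P, (c j).R))}

/-- If two ends of lifted arcs are the same point of hyperbolic space, although they are different
as pairs, then they are the two ends of a (zero length) lifted intercusp arc of the collection.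
This only says something where two horospheres touch: the intercusp arc between them is then
reduced to a point, and must not be forgotten among the arcs if it connects two of them. -/
def ContainsTouchingArcs (a : ι → IntercuspArc m) (c : κ → CuspArc m) : Prop :=
  ∀ p ∈ liftedEnds a c, ∀ q ∈ liftedEnds a c, (m.foot p ∩ m.foot q).Nonempty → p ≠ q →
    q = p.swap ∧
      ∃ g ∈ Γ, ∃ i, p = g • ((a i).P, (a i).Q) ∨ p = g • ((a i).Q, (a i).P)

/-- The intercusp parameters and the translation parameters of the arcs. -/
def parameters (a : ι → IntercuspArc m) (c : κ → CuspArc m) : Set ℂ :=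
  {w | ∃ i, m.IsIntercuspParameter (a i).P (a i).Q w} ∪
    {u | ∃ j, m.IsTranslationParameter (c j).Q (c j).P (c j).R u}

end HypThree

end

open scoped MatrixGroups

noncomputable section

namespace HypThree

/-! ### Lifting from `PSL(2, ℂ)` to `SL(2, ℂ)` -/

/-! Attach to a pair (P, Q) its frame: the isometry taking P to ∞, Q to 0 and the meridian of P to z
↦ z + 1. It is unique (`Meridians.Frame.unique`). The frames of (P, Q) and (Q, P) differ by z ↦ w /
z, those of (P, Q) and (P, R) by z ↦ z - u, so both changes lie in PGL(2, F), where F is the field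
generated by the parameters (`linked_swap`, `linked_of_translation`).

Since the preimage of X is connected, these changes compose along chains of lifted arcs
(`linked_of_meet`, `forall_of_isPreconnected_iUnion`). Hence the frames A of p and A g of g⁻¹ • p
differ by an element of PGL(2, F), that is, A g A⁻¹ lies in PGL(2, F) for every g in Γ. Squares of
such elements lift to SL(2, F), so the traces of Γ² lie in F (`invariantTraceField_le`).

For the other inclusion, w and u are rational expressions in traces of products of two or three
squared meridians, which belong to Γ² (`intercuspParameter_mem`, `translationParameter_mem`). -/

theorem exists_lift (g : PSL(2, ℂ)) : ∃ A : SL(2, ℂ), (A : PSL(2, ℂ)) = g :=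
  QuotientGroup.mk_surjective g

theorem SL_det (A : SL(2, ℂ)) : A 0 0 * A 1 1 - A 0 1 * A 1 0 = 1 := by
  have h := A.det_coe
  rwa [Matrix.det_fin_two] at h

theorem SL_ext {A B : SL(2, ℂ)} (h00 : A 0 0 = B 0 0) (h01 : A 0 1 = B 0 1)
    (h10 : A 1 0 = B 1 0) (h11 : A 1 1 = B 1 1) : A = B := by
  ext i j
  fin_cases i <;> fin_cases j <;> assumption

theorem inv00 (A : SL(2, ℂ)) : A⁻¹ 0 0 = A 1 1 := by
  simp [Matrix.SpecialLinearGroup.coe_inv, Matrix.adjugate_fin_two]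

theorem inv01 (A : SL(2, ℂ)) : A⁻¹ 0 1 = -A 0 1 := by
  simp [Matrix.SpecialLinearGroup.coe_inv, Matrix.adjugate_fin_two]

theorem inv10 (A : SL(2, ℂ)) : A⁻¹ 1 0 = -A 1 0 := by
  simp [Matrix.SpecialLinearGroup.coe_inv, Matrix.adjugate_fin_two]

theorem inv11 (A : SL(2, ℂ)) : A⁻¹ 1 1 = A 0 0 := by
  simp [Matrix.SpecialLinearGroup.coe_inv, Matrix.adjugate_fin_two]

theorem SL_mul_apply (A B : SL(2, ℂ)) (i j : Fin 2) :
    (A * B) i j = A i 0 * B 0 j + A i 1 * B 1 j := by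
  simp [Matrix.SpecialLinearGroup.coe_mul, Matrix.mul_apply, Fin.sum_univ_two]

theorem neg_mem_center : (-1 : SL(2, ℂ)) ∈ Subgroup.center SL(2, ℂ) := by
  rw [Subgroup.mem_center_iff]
  intro g
  simp

theorem mk_neg (A : SL(2, ℂ)) : ((-A : SL(2, ℂ)) : PSL(2, ℂ)) = A := by
  refine (QuotientGroup.eq.2 ?_)
  have : (-A)⁻¹ * A = -1 := by
    rw [inv_mul_eq_iff_eq_mul]
    simp
  rw [this]
  exact neg_mem_center

theorem mk_eq_mk {A B : SL(2, ℂ)} (h : (A : PSL(2, ℂ)) = B) : B = A ∨ B = -A := by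
  obtain ⟨h1, h2, h3, h4⟩ := center_cases (QuotientGroup.eq.1 h)
  have hB : B = A * (A⁻¹ * B) := by group
  rcases mul_self_eq_one_iff.1 h4 with h5 | h5
  · left
    rw [hB]
    apply SL_ext <;> rw [SL_mul_apply] <;> simp [h1, h2, h3, h5]
  · right
    rw [hB]
    apply SL_ext <;> rw [SL_mul_apply] <;>
      simp [h1, h2, h3, h5]

theorem smul_infty_eq_infty {A : SL(2, ℂ)} :
    (A : PSL(2, ℂ)) • (OnePoint.infty : OnePoint ℂ) = OnePoint.infty ↔ A 1 0 = 0 := by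
  rw [mk_smul_sphere, OnePoint.smul_infty_eq_ite]
  by_cases h : A 1 0 = 0 <;> simp [h]

theorem smul_infty_eq_coe {A : SL(2, ℂ)} {z : ℂ} :
    (A : PSL(2, ℂ)) • (OnePoint.infty : OnePoint ℂ) = (z : OnePoint ℂ) ↔
      A 1 0 ≠ 0 ∧ A 0 0 = z * A 1 0 := by
  rw [mk_smul_sphere, OnePoint.smul_infty_eq_ite]
  by_cases h : A 1 0 = 0
  · simp [h]
  · simp [h, div_eq_iff]

theorem smul_coe_eq_infty {A : SL(2, ℂ)} {z : ℂ} :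
    (A : PSL(2, ℂ)) • (z : OnePoint ℂ) = OnePoint.infty ↔ A 1 0 * z + A 1 1 = 0 := by
  rw [mk_smul_sphere, OnePoint.smul_some_eq_ite]
  by_cases h : A 1 0 * z + A 1 1 = 0 <;> simp [h]

theorem smul_coe_eq_coe {A : SL(2, ℂ)} {z w : ℂ} :
    (A : PSL(2, ℂ)) • (z : OnePoint ℂ) = (w : OnePoint ℂ) ↔
      A 1 0 * z + A 1 1 ≠ 0 ∧ A 0 0 * z + A 0 1 = w * (A 1 0 * z + A 1 1) := by
  rw [mk_smul_sphere, OnePoint.smul_some_eq_ite]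
  by_cases h : A 1 0 * z + A 1 1 = 0
  · simp [h]
  · simp [h, div_eq_iff]

/-- The translation `z ↦ z + b`. -/
def translation (b : ℂ) : SL(2, ℂ) := ⟨!![1, b; 0, 1], by simp [Matrix.det_fin_two]⟩

theorem translation_one : ((translation 1 : SL(2, ℂ)) : PSL(2, ℂ)) = T := rfl

theorem translation_mul (b b' : ℂ) :
    translation b * translation b' = translation (b + b') := by
  apply SL_ext <;> rw [SL_mul_apply] <;> simp [translation, add_comm]

theorem translation_zero : translation 0 = 1 := by
  apply SL_ext <;> simp [translation]

theorem translation_smul_coe (b z : ℂ) :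
    (translation b : PSL(2, ℂ)) • (z : OnePoint ℂ) = ((z + b : ℂ) : OnePoint ℂ) := by
  rw [smul_coe_eq_coe]
  simp [translation]

theorem translation_smul_infty (b : ℂ) :
    (translation b : PSL(2, ℂ)) • (OnePoint.infty : OnePoint ℂ) = OnePoint.infty := by
  rw [smul_infty_eq_infty]
  simp [translation]

theorem commute_T_translation (b : ℂ) :
    (translation b : PSL(2, ℂ)) * T * (translation b : PSL(2, ℂ))⁻¹ = T := by
  rw [mul_inv_eq_iff_eq_mul, ← translation_one, ← QuotientGroup.mk_mul, ← QuotientGroup.mk_mul,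
    translation_mul, translation_mul, add_comm]

/-- An isometry fixing ∞ acts as z ↦ a z + b, and commuting with z ↦ z + 1 forces a = 1. -/
theorem eq_translation_of_commute_T {C : PSL(2, ℂ)}
    (hinf : C • (OnePoint.infty : OnePoint ℂ) = OnePoint.infty)
    (hT : C * T * C⁻¹ = T) : ∃ b : ℂ, C = translation b := by
  obtain ⟨A, rfl⟩ := exists_lift C
  rw [smul_infty_eq_infty] at hinf
  rw [mul_inv_eq_iff_eq_mul, ← translation_one, ← QuotientGroup.mk_mul,
    ← QuotientGroup.mk_mul] at hT
  have hdet := SL_det A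
  have key : A 0 0 = A 1 1 := by
    rcases mk_eq_mk hT with h | h
    · have h2 := congrArg (fun X : SL(2, ℂ) => X 0 1) h
      simp only [SL_mul_apply] at h2
      simp [translation] at h2
      linear_combination -h2
    -- The matrices might commute only up to sign; this would make the upper left entry 0, against
    -- determinant 1.
    · have h2 := congrArg (fun X : SL(2, ℂ) => X 0 0) h
      simp only [SL_mul_apply, Matrix.SpecialLinearGroup.coe_neg, Matrix.neg_apply] at h2
      simp [translation, hinf] at h2
      have : A 0 0 = 0 := by linear_combination h2 / 2
      simp [this, hinf] at hdet
  have hsq : A 0 0 * A 0 0 = 1 := by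
    rw [← key, hinf] at hdet
    linear_combination hdet
  rcases mul_self_eq_one_iff.1 hsq with h | h
  · refine ⟨A 0 1, congrArg _ ?_⟩
    apply SL_ext <;> simp [translation, h, hinf, ← key]
  · refine ⟨-A 0 1, ?_⟩
    rw [← mk_neg A]
    refine congrArg _ ?_
    apply SL_ext <;> simp [translation, h, hinf, ← key]

/-! ### Frames -/

variable {Γ : Subgroup PSL(2, ℂ)} {m : Meridians Γ}

theorem Meridians.Positions.eq_translation {P : OnePoint ℂ} {A B : PSL(2, ℂ)}
    (hA : m.Positions P A) (hB : m.Positions P B) : ∃ b : ℂ, B = translation b * A := by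
  obtain ⟨b, hb⟩ := eq_translation_of_commute_T (C := B * A⁻¹)
    (by rw [mul_smul, inv_smul_eq_iff.2 hA.1.symm, hB.1])
    (by
      have h : m.mer P = A⁻¹ * T * A := by rw [← hA.2]; group
      calc B * A⁻¹ * T * (B * A⁻¹)⁻¹ = B * (A⁻¹ * T * A) * B⁻¹ := by group
        _ = T := by rw [← h, hB.2])
  exact ⟨b, by rw [← hb]; group⟩

theorem Meridians.Positions.translate {P : OnePoint ℂ} {A : PSL(2, ℂ)}
    (hA : m.Positions P A) (b : ℂ) : m.Positions P (translation b * A) := by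
  refine ⟨by rw [mul_smul, hA.1, translation_smul_infty], ?_⟩
  have h := commute_T_translation b
  rw [← hA.2] at h ⊢
  rw [← h]
  group

theorem Meridians.Positions.smul {P : OnePoint ℂ} {A : PSL(2, ℂ)} (hP : IsCusp Γ P)
    (hA : m.Positions P A) {g : PSL(2, ℂ)} (hg : g ∈ Γ) : m.Positions (g • P) (A * g⁻¹) := by
  refine ⟨by rw [mul_smul, inv_smul_smul, hA.1], ?_⟩
  rw [m.equivariant P hP g hg, ← hA.2]
  group

theorem exists_coe_of_ne_infty {P : OnePoint ℂ} (h : P ≠ OnePoint.infty) :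
    ∃ z : ℂ, P = (z : OnePoint ℂ) := by
  obtain ⟨z, hz⟩ := OnePoint.ne_infty_iff_exists.1 h
  exact ⟨z, hz.symm⟩

/-- The isometry `A` positions `p.1` at `∞` with the meridian acting as `z ↦ z + 1`, and `p.2`
at `0`. -/
def Meridians.Frame (m : Meridians Γ) (p : OnePoint ℂ × OnePoint ℂ) (A : PSL(2, ℂ)) : Prop :=
  m.Positions p.1 A ∧ A • p.2 = ((0 : ℂ) : OnePoint ℂ)

theorem Meridians.exists_positions_coe {P Q : OnePoint ℂ} {A : PSL(2, ℂ)} (hA : m.Positions P A)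
    (hne : P ≠ Q) : ∃ z : ℂ, A • Q = (z : OnePoint ℂ) := by
  apply exists_coe_of_ne_infty
  rw [← hA.1]
  exact fun h => hne (smul_left_cancel A h).symm

theorem Meridians.Positions.frame {P Q : OnePoint ℂ} {A : PSL(2, ℂ)} (hA : m.Positions P A)
    {z : ℂ} (hz : A • Q = (z : OnePoint ℂ)) : m.Frame (P, Q) (translation (-z) * A) :=
  ⟨hA.translate _, by rw [mul_smul, hz, translation_smul_coe, add_neg_cancel]⟩

theorem Meridians.exists_frame (m : Meridians Γ) {P Q : OnePoint ℂ} (hP : IsCusp Γ P)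
    (hne : P ≠ Q) : ∃ A, m.Frame (P, Q) A := by
  obtain ⟨A, hA⟩ := m.parabolic P hP
  obtain ⟨z, hz⟩ := Meridians.exists_positions_coe (m := m) hA hne
  exact ⟨_, Meridians.Positions.frame hA hz⟩

/-- Two positionings of the same centre differ by a translation, and a translation fixing 0 is
trivial. -/
theorem Meridians.Frame.unique {p : OnePoint ℂ × OnePoint ℂ} {A B : PSL(2, ℂ)}
    (hA : m.Frame p A) (hB : m.Frame p B) : A = B := by
  obtain ⟨b, rfl⟩ := hA.1.eq_translation hB.1
  have h := hB.2
  rw [mul_smul, hA.2, translation_smul_coe, zero_add] at h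
  rw [OnePoint.coe_injective h, translation_zero]
  simp

theorem Meridians.Frame.smul {p : OnePoint ℂ × OnePoint ℂ} {A : PSL(2, ℂ)} (hP : IsCusp Γ p.1)
    (hA : m.Frame p A) {g : PSL(2, ℂ)} (hg : g ∈ Γ) : m.Frame (g • p) (A * g⁻¹) :=
  ⟨hA.1.smul hP hg, by rw [Prod.smul_snd, mul_smul, inv_smul_smul, hA.2]⟩

theorem smul_foot {p : OnePoint ℂ × OnePoint ℂ} (hP : IsCusp Γ p.1) {g : PSL(2, ℂ)}
    (hg : g ∈ Γ) {x : H3} (hx : x ∈ m.foot p) : g • x ∈ m.foot (g • p) := by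
  obtain ⟨⟨A, hA, hAx⟩, B, hB1, hB2, hB3⟩ := hx
  refine ⟨⟨A * g⁻¹, hA.smul hP hg, by rwa [mul_smul, inv_smul_smul]⟩, B * g⁻¹, ?_, ?_, ?_⟩
  · rw [Prod.smul_fst, mul_smul, inv_smul_smul, hB1]
  · rw [Prod.smul_snd, mul_smul, inv_smul_smul, hB2]
  · rwa [mul_smul, inv_smul_smul]

/-- An isometry fixing `∞` acts on horizontal coordinates of interior points as on `ℂ`. -/
theorem z_smul_of_fixes_infty {C : PSL(2, ℂ)}
    (hC : C • (OnePoint.infty : OnePoint ℂ) = OnePoint.infty)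
    (x : H3) : C • ((x.z : ℂ) : OnePoint ℂ) = (((C • x).z : ℂ) : OnePoint ℂ) := by
  obtain ⟨A, rfl⟩ := exists_lift C
  rw [smul_infty_eq_infty] at hC
  have hdet := SL_det A
  have hd : A 1 1 ≠ 0 := by
    intro h
    simp [hC, h] at hdet
  rw [smul_coe_eq_coe, mk_smul_H3]
  refine ⟨by simpa [hC] using hd, ?_⟩
  have hz : (act A x).z = num A x / (den A x : ℂ) := rfl
  have hs : star (A 1 1) ≠ 0 := star_ne_zero.2 hd
  rw [hz, den_ofReal, num]
  simp only [hC, zero_mul, zero_add, star_zero, mul_zero, add_zero]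
  field_simp

/-- Seen with P at ∞, the geodesic is the vertical line over the image of Q. Feet on horospheres can
thus be replaced by ideal points. -/
theorem z_of_mem_foot {P Q : OnePoint ℂ} {A : PSL(2, ℂ)} (hA : A • P = OnePoint.infty) {x : H3}
    (hx : x ∈ geodesic P Q) : A • Q = (((A • x).z : ℂ) : OnePoint ℂ) := by
  obtain ⟨B, hB1, hB2, hB3⟩ := hx
  have h := z_smul_of_fixes_infty (C := A * B⁻¹)
    (by rw [mul_smul, inv_smul_eq_iff.2 hB1.symm, hA]) (B • x)
  rwa [hB3, ← hB2, ← mul_smul, ← mul_smul, inv_mul_cancel_right] at h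

theorem foot_nonempty {P Q : OnePoint ℂ} (hP : IsCusp Γ P) (hne : P ≠ Q) :
    (m.foot (P, Q)).Nonempty := by
  obtain ⟨A, hA⟩ := m.exists_frame hP hne
  refine ⟨A⁻¹ • H3.mk 0 1 one_pos, ⟨A, hA.1, ?_⟩, A, hA.1.1, hA.2, ?_⟩
  · rw [smul_inv_smul]; rfl
  · rw [smul_inv_smul]; rfl

/-! ### Parameters in terms of matrices -/

theorem entry_one_zero_ne_zero {C : SL(2, ℂ)} (h : C 1 1 = 0) : C 1 0 ≠ 0 := by
  intro h0
  have := SL_det C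
  simp [h, h0] at this

/-- On the boundary C is z ↦ a/c - 1/(c² z). The extension to the interior replaces 1/z by conj z /
(|z|² + t²), here with z = s real. -/
theorem z_act_of_entry_one_one_eq_zero {C : SL(2, ℂ)} (h : C 1 1 = 0) (t : ℝ) (ht : 0 < t)
    (s : ℝ) :
    (act C (H3.mk (s : ℂ) t ht)).z =
      C 0 0 / C 1 0 - 1 / C 1 0 ^ 2 * (s / (s ^ 2 + t ^ 2)) := by
  have hc := entry_one_zero_ne_zero h
  have hs : star (C 1 0) ≠ 0 := star_ne_zero.2 hc
  have hdet := SL_det C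
  have hb : C 0 1 = -1 / C 1 0 := by
    rw [eq_div_iff hc]
    rw [h] at hdet
    linear_combination -hdet
  have hst : ((s : ℂ) ^ 2 + (t : ℂ) ^ 2) ≠ 0 := by
    have : 0 < s ^ 2 + t ^ 2 := by positivity
    exact_mod_cast this.ne'
  have hz : (act C (H3.mk (s : ℂ) t ht)).z =
    num C (H3.mk (s : ℂ) t ht) / (den C (H3.mk (s : ℂ) t ht) : ℂ) := rfl
  have h1 : (H3.mk (s : ℂ) t ht).z = s := rfl
  have h2 : (H3.mk (s : ℂ) t ht).t = t := rfl
  have hss : star (s : ℂ) = s := Complex.conj_ofReal s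
  have hden : C 1 0 * (s : ℂ) * (star (C 1 0) * s) + C 1 0 * star (C 1 0) * (t : ℂ) ^ 2 =
      C 1 0 * star (C 1 0) * ((s : ℂ) ^ 2 + (t : ℂ) ^ 2) := by ring
  rw [hz, den_ofReal, num, h1, h2, h, hb]
  simp only [add_zero, star_mul', hss]
  rw [hden]
  field_simp
  ring

theorem t_act_of_entry_one_one_eq_zero {C : SL(2, ℂ)} (h : C 1 1 = 0) (t : ℝ) (ht : 0 < t) :
    (act C (H3.mk 0 t ht)).t = 1 / (‖C 1 0‖ ^ 2 * t) := by
  have hc := norm_pos_iff.2 (entry_one_zero_ne_zero h)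
  have h0 : (act C (H3.mk 0 t ht)).t = t / den C (H3.mk 0 t ht) := rfl
  have h1 : (H3.mk 0 t ht).z = 0 := rfl
  have h2 : (H3.mk 0 t ht).t = t := rfl
  rw [h0, den, h1, h2, h, ← Complex.sq_norm, ← Complex.sq_norm]
  simp
  field_simp

theorem hasDerivAt_z_act {C : SL(2, ℂ)} (h : C 1 1 = 0) (t : ℝ) (ht : 0 < t) :
    HasDerivAt (fun s : ℝ => (act C (H3.mk (s : ℂ) t ht)).z) (-1 / C 1 0 ^ 2 / t ^ 2) 0 := by
  have h1 : HasDerivAt (fun s : ℝ => s / (s ^ 2 + t ^ 2)) (1 / t ^ 2) 0 := by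
    have h2 : HasDerivAt (fun s : ℝ => s ^ 2 + t ^ 2) (2 * 0) 0 := by
      simpa using (hasDerivAt_pow 2 (0 : ℝ)).add_const (t ^ 2)
    have h3 := (hasDerivAt_id (0 : ℝ)).div h2 (by positivity)
    exact h3.congr_deriv (by simp; field_simp)
  have h4 := ((h1.ofReal_comp.const_mul (1 / C 1 0 ^ 2)).const_sub (C 0 0 / C 1 0))
  refine (h4.congr_deriv (by push_cast; ring)).congr_of_eventuallyEq (.of_forall fun s => ?_)
  beta_reduce
  rw [z_act_of_entry_one_one_eq_zero h]
  push_cast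
  rfl

/-- The height condition says t = 1/|c|², and the derivative -1/(c² t²) has the direction of -1/c².
Together they say that t and ζ are the modulus and the phase of -1/c². -/
theorem height_and_direction_iff {C : SL(2, ℂ)} (h : C 1 1 = 0) (t : ℝ) (ht : 0 < t) {ζ : ℂ}
    (hζ : ‖ζ‖ = 1) :
    ((act C (H3.mk 0 t ht)).t = 1 ∧ ∃ r : ℝ, 0 < r ∧
      HasDerivAt (fun s : ℝ => (act C (H3.mk (s : ℂ) t ht)).z) (r * ζ) 0) ↔
      t * ζ = -1 / C 1 0 ^ 2 := by
  have hc := entry_one_zero_ne_zero h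
  have hn := norm_pos_iff.2 hc
  have hder := hasDerivAt_z_act h t ht
  have htc : (t : ℂ) ≠ 0 := by exact_mod_cast ht.ne'
  rw [t_act_of_entry_one_one_eq_zero h]
  constructor
  · rintro ⟨h1, r, hr, hd⟩
    have h2 := hd.unique hder
    have h3 := congrArg norm h2
    rw [norm_mul, hζ, norm_div, norm_div, norm_pow, norm_pow, norm_neg, norm_one, mul_one,
      Complex.norm_real, Complex.norm_real, Real.norm_of_nonneg hr.le,
      Real.norm_of_nonneg ht.le] at h3
    have h5 : r * t = 1 := by
      rw [div_eq_one_iff_eq (by positivity)] at h1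
      rw [h3]
      field_simp
      exact h1
    have h6 : (r : ℂ) * t = 1 := by exact_mod_cast h5
    have h7 : -1 / C 1 0 ^ 2 = r * ζ * t ^ 2 := by
      rw [h2]
      field_simp
    rw [h7]
    linear_combination (-(t : ℂ) * ζ) * h6
  · intro he
    have h3 := congrArg norm he
    rw [norm_mul, hζ, norm_div, norm_pow, norm_neg, norm_one, mul_one,
      Complex.norm_real, Real.norm_of_nonneg ht.le] at h3
    -- The derivative is t ζ / t², of modulus 1/t.
    refine ⟨by rw [h3]; field_simp, 1 / t, by positivity, hder.congr_deriv ?_⟩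
    rw [← he]
    push_cast
    field_simp

theorem distance_condition_iff {C : SL(2, ℂ)} (h : C 1 1 = 0) (δ : ℂ) :
    (((C : PSL(2, ℂ)) • H3.mk 0 (Real.exp (-δ.re)) (Real.exp_pos _)).t = 1 ∧
      ∃ r : ℝ, 0 < r ∧ HasDerivAt
        (fun s : ℝ => ((C : PSL(2, ℂ)) • H3.mk (s : ℂ) (Real.exp (-δ.re)) (Real.exp_pos _)).z)
        (r * Complex.exp (-(δ.im * Complex.I))) 0) ↔
      Complex.exp (-δ) = -1 / C 1 0 ^ 2 := by
  have hexp : Complex.exp (-δ) =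
      (Real.exp (-δ.re) : ℂ) * Complex.exp (-(δ.im * Complex.I)) := by
    rw [Complex.ofReal_exp, ← Complex.exp_add]
    congr 1
    conv_lhs => rw [← Complex.re_add_im δ]
    push_cast
    ring
  have hne : ‖Complex.exp (-(δ.im * Complex.I))‖ = 1 := by
    have := Complex.norm_exp_ofReal_mul_I (-δ.im)
    rwa [Complex.ofReal_neg, neg_mul] at this
  rw [hexp]
  exact height_and_direction_iff h _ _ hne

theorem entry_one_one_eq_zero {Q : OnePoint ℂ} {A B : PSL(2, ℂ)}
    (hA : A • Q = ((0 : ℂ) : OnePoint ℂ)) (hB : m.Positions Q B) {C : SL(2, ℂ)}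
    (hC : (C : PSL(2, ℂ)) = B * A⁻¹) : C 1 1 = 0 := by
  have h : (C : PSL(2, ℂ)) • ((0 : ℂ) : OnePoint ℂ) = OnePoint.infty := by
    rw [hC, mul_smul, inv_smul_eq_iff.2 hA.symm, hB.1]
  simpa using smul_coe_eq_infty.1 h

/-- The frame A is unique, and another choice of B multiplies C on the left by a translation, which
keeps its lower row. So the parameter exists and is unique. -/
theorem isIntercuspParameter_iff {P Q : OnePoint ℂ} {A B : PSL(2, ℂ)} (hA : m.Frame (P, Q) A)
    (hB : m.Positions Q B) {C : SL(2, ℂ)} (hC : (C : PSL(2, ℂ)) = B * A⁻¹) (w : ℂ) :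
    m.IsIntercuspParameter P Q w ↔ w = -1 / C 1 0 ^ 2 := by
  have h11 := entry_one_one_eq_zero (m := m) hA.2 hB hC
  have hc := entry_one_zero_ne_zero h11
  constructor
  · rintro ⟨δ, ⟨A', B', hA', hA'Q, hB', h⟩, rfl⟩
    obtain rfl := hA.unique (p := (P, Q)) ⟨hA', hA'Q⟩
    obtain ⟨b, rfl⟩ := hB.eq_translation hB'
    have hC' : ((translation b * C : SL(2, ℂ)) : PSL(2, ℂ)) = translation b * B * A⁻¹ := by
      rw [QuotientGroup.mk_mul, hC, mul_assoc]
    have e1 : (translation b * C) 1 0 = C 1 0 := by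
      rw [SL_mul_apply]; simp [translation]
    have e2 : (translation b * C) 1 1 = 0 := by
      rw [SL_mul_apply]; simp [translation, h11]
    rw [← hC', distance_condition_iff e2, e1] at h
    exact h
  · intro hw
    have hw0 : w ≠ 0 := by
      rw [hw]
      exact div_ne_zero (by norm_num) (pow_ne_zero _ hc)
    -- Any logarithm serves as a complex distance, since the conditions involve δ only through exp
    -- (-δ).
    have he : Complex.exp (-(-Complex.log w)) = w := by rw [neg_neg, Complex.exp_log hw0]
    refine ⟨-Complex.log w, ⟨A, B, hA.1, hA.2, hB, ?_⟩, he.symm⟩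
    rw [← hC, distance_condition_iff h11, he, hw]

theorem isTranslationParameter_iff {Q P R : OnePoint ℂ} (hP : IsCusp Γ P) (hQ : P ≠ Q)
    (hR : P ≠ R) {A : PSL(2, ℂ)} (hA : m.Positions P A) {z z' : ℂ}
    (hz : A • Q = (z : OnePoint ℂ)) (hz' : A • R = (z' : OnePoint ℂ)) (u : ℂ) :
    m.IsTranslationParameter Q P R u ↔ u = z' - z := by
  constructor
  · rintro ⟨A', hA', x, hx, y, hy, rfl⟩
    obtain ⟨b, rfl⟩ := hA.eq_translation hA'
    have h1 := z_of_mem_foot hA'.1 hx.2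
    have h2 := z_of_mem_foot hA'.1 hy.2
    rw [mul_smul, hz, translation_smul_coe] at h1
    rw [mul_smul, hz', translation_smul_coe] at h2
    rw [← OnePoint.coe_injective h1, ← OnePoint.coe_injective h2]
    ring
  · rintro rfl
    obtain ⟨x, hx⟩ := foot_nonempty (m := m) hP hQ
    obtain ⟨y, hy⟩ := foot_nonempty (m := m) hP hR
    refine ⟨A, hA, x, hx, y, hy, ?_⟩
    have h1 := z_of_mem_foot hA.1 hx.2
    have h2 := z_of_mem_foot hA.1 hy.2
    rw [hz] at h1
    rw [hz'] at h2
    rw [OnePoint.coe_injective h1, OnePoint.coe_injective h2]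

/-! ### The parameters lie in the invariant trace field -/

/-- The parabolic matrix fixing `z` with lower left entry `q`. -/
def parabolicMatrix (q z : ℂ) : SL(2, ℂ) :=
  ⟨!![1 + q * z, -(q * z ^ 2); q, 1 - q * z], by rw [Matrix.det_fin_two_of]; ring⟩

theorem parabolicMatrix_sq (q z : ℂ) :
    parabolicMatrix q z ^ 2 = parabolicMatrix (2 * q) z := by
  rw [pow_two]
  apply SL_ext <;> rw [SL_mul_apply] <;> simp [parabolicMatrix] <;> ring

theorem trace_eq (A : SL(2, ℂ)) :
    Matrix.trace (A : Matrix (Fin 2) (Fin 2) ℂ) = A 0 0 + A 1 1 :=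
  Matrix.trace_fin_two _

/-- Seen through A, the meridian of Q is C⁻¹ T C. As C takes z to ∞, its lower row is (c, -c z), and
this row alone determines the conjugate. -/
theorem conj_mer {Q : OnePoint ℂ} {A B : PSL(2, ℂ)} {z : ℂ} (hA : A • Q = (z : OnePoint ℂ))
    (hB : m.Positions Q B) {C : SL(2, ℂ)} (hC : (C : PSL(2, ℂ)) = B * A⁻¹) :
    A * m.mer Q * A⁻¹ = (parabolicMatrix (-C 1 0 ^ 2) z : PSL(2, ℂ)) ∧ C 1 0 ≠ 0 := by
  have hCz : C 1 0 * z + C 1 1 = 0 := by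
    refine smul_coe_eq_infty.1 ?_
    rw [hC, mul_smul, inv_smul_eq_iff.2 hA.symm, hB.1]
  have hdet := SL_det C
  constructor
  · have h1 : A * m.mer Q * A⁻¹ = (C : PSL(2, ℂ))⁻¹ * T * C := by
      rw [hC, ← hB.2]
      group
    rw [h1, ← translation_one, ← QuotientGroup.mk_inv, ← QuotientGroup.mk_mul,
      ← QuotientGroup.mk_mul]
    congr 1
    have hd : C 1 1 = -(C 1 0 * z) := by linear_combination hCz
    rw [hd] at hdet
    apply SL_ext <;> rw [SL_mul_apply, SL_mul_apply, SL_mul_apply] <;>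
      simp only [inv00, inv01, inv10, inv11] <;>
      simp [parabolicMatrix, translation, hd]
    · linear_combination hdet
    · ring
    · ring
    · linear_combination hdet
  · intro h0
    rw [h0, zero_mul, zero_add] at hCz
    simp [h0, hCz] at hdet

theorem trace_mem_invariantTraceField {g A : PSL(2, ℂ)}
    (hg : g ∈ Subgroup.closure {h | ∃ g ∈ Γ, h = g ^ 2}) {X : SL(2, ℂ)}
    (hX : A * g * A⁻¹ = X) : X 0 0 + X 1 1 ∈ invariantTraceField Γ := by
  obtain ⟨B, rfl⟩ := exists_lift A
  refine IntermediateField.subset_adjoin ℚ _ ⟨B⁻¹ * X * B, ?_, ?_⟩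
  · rw [QuotientGroup.mk_mul, QuotientGroup.mk_mul, QuotientGroup.mk_inv, ← hX]
    have h : (B : PSL(2, ℂ))⁻¹ * (B * g * (B : PSL(2, ℂ))⁻¹) * B = g := by group
    rwa [h]
  · rw [← trace_eq, Matrix.SpecialLinearGroup.coe_mul, Matrix.trace_mul_comm,
      ← Matrix.SpecialLinearGroup.coe_mul]
    have h : B * (B⁻¹ * X) = X := by group
    rw [h]

theorem conj_mer_sq {Q : OnePoint ℂ} {A : PSL(2, ℂ)} {q z : ℂ}
    (h : A * m.mer Q * A⁻¹ = (parabolicMatrix q z : PSL(2, ℂ))) :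
    A * m.mer Q ^ 2 * A⁻¹ = (parabolicMatrix (2 * q) z : PSL(2, ℂ)) := by
  rw [← parabolicMatrix_sq, QuotientGroup.mk_pow, ← h, conj_pow]

theorem mer_sq_mem {P : OnePoint ℂ} (hP : IsCusp Γ P) :
    m.mer P ^ 2 ∈ Subgroup.closure {h | ∃ g ∈ Γ, h = g ^ 2} :=
  Subgroup.subset_closure ⟨_, m.mem P hP, rfl⟩

theorem conj_mer_sq_eq_translation {P : OnePoint ℂ} {A : PSL(2, ℂ)} (hA : m.Positions P A) :
    A * m.mer P ^ 2 * A⁻¹ = (translation 2 : PSL(2, ℂ)) := by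
  rw [← conj_pow, hA.2, ← translation_one, ← QuotientGroup.mk_pow, pow_two, translation_mul]
  norm_num

/-- With P at ∞, the product of the squared meridians of P and Q has trace 2 + 4 q. For a frame, q
is the inverse of the intercusp parameter. -/
theorem mem_invariantTraceField_of_conj_mer {P Q : OnePoint ℂ} (hP : IsCusp Γ P) (hQ : IsCusp Γ Q)
    {A : PSL(2, ℂ)} (hA : m.Positions P A) {q z : ℂ}
    (h : A * m.mer Q * A⁻¹ = (parabolicMatrix q z : PSL(2, ℂ))) :
    q ∈ invariantTraceField Γ := by
  have h1 : A * (m.mer P ^ 2 * m.mer Q ^ 2) * A⁻¹ =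
      ((translation 2 * parabolicMatrix (2 * q) z : SL(2, ℂ)) : PSL(2, ℂ)) := by
    rw [QuotientGroup.mk_mul, ← conj_mer_sq h, ← conj_mer_sq_eq_translation hA]
    group
  have h2 := trace_mem_invariantTraceField (Subgroup.mul_mem _ (mer_sq_mem hP) (mer_sq_mem hQ)) h1
  rw [SL_mul_apply, SL_mul_apply] at h2
  simp only [parabolicMatrix, translation] at h2
  simp at h2
  have h3 := (invariantTraceField Γ).div_mem
    ((invariantTraceField Γ).sub_mem h2 (natCast_mem _ 2)) (natCast_mem (invariantTraceField Γ) 4)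
  convert h3 using 1
  push_cast
  ring

theorem intercuspParameter_mem {P Q : OnePoint ℂ} (hP : IsCusp Γ P) (hQ : IsCusp Γ Q)
    (hne : P ≠ Q) {w : ℂ} (hw : m.IsIntercuspParameter P Q w) : w ∈ invariantTraceField Γ := by
  obtain ⟨A, hA⟩ := m.exists_frame hP hne
  obtain ⟨B, hB⟩ := m.exists_frame hQ hne.symm
  obtain ⟨C, hC⟩ := exists_lift (B * A⁻¹)
  rw [isIntercuspParameter_iff hA hB.1 hC] at hw
  have h := mem_invariantTraceField_of_conj_mer hP hQ hA.1 (conj_mer hA.2 hB.1 hC).1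
  have : w = (-C 1 0 ^ 2)⁻¹ := by rw [hw, inv_neg, neg_div, one_div]
  rw [this]
  exact (invariantTraceField Γ).inv_mem h

/-- Multiplying a matrix on the left by the translation by 2 adds twice its lower left entry to the
trace. Applied to the product of the squared meridians of Q and R, this puts 4 (q + r + 2 q r u)
into the field, and q r ≠ 0 allows solving for u. -/
theorem translationParameter_mem {Q P R : OnePoint ℂ} (hQ : IsCusp Γ Q) (hP : IsCusp Γ P)
    (hR : IsCusp Γ R) (hneQ : P ≠ Q) (hneR : P ≠ R) {u : ℂ}
    (hu : m.IsTranslationParameter Q P R u) : u ∈ invariantTraceField Γ := by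
  obtain ⟨A, hA⟩ := m.parabolic P hP
  obtain ⟨B, hB⟩ := m.parabolic Q hQ
  obtain ⟨B', hB'⟩ := m.parabolic R hR
  obtain ⟨z, hz⟩ := Meridians.exists_positions_coe (m := m) hA hneQ
  obtain ⟨z', hz'⟩ := Meridians.exists_positions_coe (m := m) hA hneR
  obtain ⟨C, hC⟩ := exists_lift (B * A⁻¹)
  obtain ⟨C', hC'⟩ := exists_lift (B' * A⁻¹)
  rw [isTranslationParameter_iff hP hneQ hneR hA hz hz'] at hu
  obtain ⟨h1, hc⟩ := conj_mer (m := m) hz hB hC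
  obtain ⟨h2, hc'⟩ := conj_mer (m := m) hz' hB' hC'
  have hq := mem_invariantTraceField_of_conj_mer hP hQ hA h1
  have hr := mem_invariantTraceField_of_conj_mer hP hR hA h2
  have hq0 : -C 1 0 ^ 2 ≠ 0 := neg_ne_zero.2 (pow_ne_zero _ hc)
  have hr0 : -C' 1 0 ^ 2 ≠ 0 := neg_ne_zero.2 (pow_ne_zero _ hc')
  generalize -C 1 0 ^ 2 = q at *
  generalize -C' 1 0 ^ 2 = r at *
  have e1 : A * (m.mer Q ^ 2 * m.mer R ^ 2) * A⁻¹ =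
      ((parabolicMatrix (2 * q) z * parabolicMatrix (2 * r) z' : SL(2, ℂ)) : PSL(2, ℂ)) := by
    rw [QuotientGroup.mk_mul, ← conj_mer_sq h1, ← conj_mer_sq h2]
    group
  have e2 : A * (m.mer P ^ 2 * (m.mer Q ^ 2 * m.mer R ^ 2)) * A⁻¹ =
      ((translation 2 * (parabolicMatrix (2 * q) z * parabolicMatrix (2 * r) z') : SL(2, ℂ)) :
        PSL(2, ℂ)) := by
    rw [QuotientGroup.mk_mul, ← e1, ← conj_mer_sq_eq_translation hA]
    group
  have hmem := Subgroup.mul_mem _ (mer_sq_mem (m := m) hQ) (mer_sq_mem (m := m) hR)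
  have t1 := trace_mem_invariantTraceField hmem e1
  have t2 := trace_mem_invariantTraceField (Subgroup.mul_mem _ (mer_sq_mem (m := m) hP) hmem) e2
  have key : (translation 2 * (parabolicMatrix (2 * q) z * parabolicMatrix (2 * r) z')) 0 0 +
      (translation 2 * (parabolicMatrix (2 * q) z * parabolicMatrix (2 * r) z')) 1 1 =
      (parabolicMatrix (2 * q) z * parabolicMatrix (2 * r) z') 0 0 +
      (parabolicMatrix (2 * q) z * parabolicMatrix (2 * r) z') 1 1 +
      4 * (q + r + 2 * (q * r) * (z' - z)) := by
    simp only [SL_mul_apply]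
    simp [parabolicMatrix, translation]
    ring
  have hu' : u = (((translation 2 * (parabolicMatrix (2 * q) z * parabolicMatrix (2 * r) z')) 0 0 +
      (translation 2 * (parabolicMatrix (2 * q) z * parabolicMatrix (2 * r) z')) 1 1 -
      ((parabolicMatrix (2 * q) z * parabolicMatrix (2 * r) z') 0 0 +
      (parabolicMatrix (2 * q) z * parabolicMatrix (2 * r) z') 1 1)) / (4 : ℕ) - (q + r)) /
      ((2 : ℕ) * (q * r)) := by
    rw [key, hu]
    push_cast
    field_simp
    ring
  rw [hu']
  exact div_mem (sub_mem (div_mem (sub_mem t2 t1) (natCast_mem _ _)) (add_mem hq hr))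
    (mul_mem (natCast_mem _ _) (mul_mem hq hr))

/-! ### Matrices over a subfield -/

/-- The matrices with entries in the field `F`. -/
def matricesOver (F : IntermediateField ℚ ℂ) : Subgroup SL(2, ℂ) where
  carrier := {A | ∀ i j, A i j ∈ F}
  one_mem' := by
    intro i j
    fin_cases i <;> fin_cases j <;> simp
  mul_mem' := by
    intro A B hA hB i j
    rw [SL_mul_apply]
    exact add_mem (mul_mem (hA _ _) (hB _ _)) (mul_mem (hA _ _) (hB _ _))
  inv_mem' := by
    intro A hA
    simp only [Set.mem_ofPred_eq, Fin.forall_fin_two, inv00, inv01, inv10, inv11]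
    exact ⟨⟨hA 1 1, neg_mem (hA 0 1)⟩, neg_mem (hA 1 0), hA 0 0⟩

/-- The matrices that are proportional to a matrix with entries in the field `F`. -/
def scaledMatricesOver (F : IntermediateField ℚ ℂ) : Subgroup SL(2, ℂ) where
  carrier := {A | ∃ l : ℂ, l ≠ 0 ∧ ∀ i j, l * A i j ∈ F}
  one_mem' := ⟨1, one_ne_zero, fun i j => by fin_cases i <;> fin_cases j <;> simp⟩
  mul_mem' := by
    rintro A B ⟨l, hl, hA⟩ ⟨k, hk, hB⟩
    refine ⟨l * k, mul_ne_zero hl hk, fun i j => ?_⟩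
    rw [SL_mul_apply]
    convert add_mem (mul_mem (hA i 0) (hB 0 j)) (mul_mem (hA i 1) (hB 1 j)) using 1
    ring
  inv_mem' := by
    rintro A ⟨l, hl, hA⟩
    refine ⟨l, hl, ?_⟩
    simp only [Fin.forall_fin_two, inv00, inv01, inv10, inv11, mul_neg]
    exact ⟨⟨hA 1 1, neg_mem (hA 0 1)⟩, neg_mem (hA 1 0), hA 0 0⟩

/-- The scalar l need not lie in F, but l² = det (l A) does, and A² = (l A)² / l². This is why
squares appear in the invariant trace field. -/
theorem sq_mem_matricesOver {F : IntermediateField ℚ ℂ} {A : SL(2, ℂ)}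
    (hA : A ∈ scaledMatricesOver F) : A ^ 2 ∈ matricesOver F := by
  obtain ⟨l, hl, h⟩ := hA
  have hl2 : l ^ 2 ∈ F := by
    convert sub_mem (mul_mem (h 0 0) (h 1 1)) (mul_mem (h 0 1) (h 1 0)) using 1
    linear_combination (-l ^ 2) * SL_det A
  intro i j
  rw [pow_two, SL_mul_apply]
  convert div_mem (add_mem (mul_mem (h i 0) (h 0 j)) (mul_mem (h i 1) (h 1 j))) hl2 using 1
  field_simp

/-- The image of `PGL(2, F) ∩ PSL(2, ℂ)`. -/
def scaledOver (F : IntermediateField ℚ ℂ) : Subgroup PSL(2, ℂ) :=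
  (scaledMatricesOver F).map (QuotientGroup.mk' _)

theorem invariantTraceField_le {F : IntermediateField ℚ ℂ} (A : PSL(2, ℂ))
    (h : ∀ g ∈ Γ, A * g * A⁻¹ ∈ scaledOver F) : invariantTraceField Γ ≤ F := by
  obtain ⟨A, rfl⟩ := exists_lift A
  have hcl : Subgroup.closure {h | ∃ g ∈ Γ, h = g ^ 2} ≤
      ((matricesOver F).map (QuotientGroup.mk' _)).comap
        (MulAut.conj (A : PSL(2, ℂ))).toMonoidHom := by
    rw [Subgroup.closure_le]
    rintro _ ⟨g, hg, rfl⟩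
    obtain ⟨B, hB, hBg⟩ := h g hg
    refine ⟨B ^ 2, sq_mem_matricesOver hB, ?_⟩
    rw [map_pow, hBg, conj_pow]
    rfl
  refine IntermediateField.adjoin_le_iff.2 ?_
  rintro _ ⟨X, hX, rfl⟩
  obtain ⟨B, hB, hBX⟩ := hcl hX
  have h1 : (B : PSL(2, ℂ)) = ((A * X * A⁻¹ : SL(2, ℂ)) : PSL(2, ℂ)) := hBX
  have h2 : Matrix.trace (X : Matrix (Fin 2) (Fin 2) ℂ) =
      (A * X * A⁻¹) 0 0 + (A * X * A⁻¹) 1 1 := by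
    rw [← trace_eq, Matrix.SpecialLinearGroup.coe_mul, Matrix.trace_mul_comm,
      ← Matrix.SpecialLinearGroup.coe_mul]
    have h : A⁻¹ * (A * X) = X := by group
    rw [h]
  rw [h2]
  -- The lift is determined up to sign, which only changes the sign of the trace.
  rcases mk_eq_mk h1 with h | h <;> rw [h]
  · exact add_mem (hB 0 0) (hB 1 1)
  · simp only [Matrix.SpecialLinearGroup.coe_neg, Matrix.neg_apply]
    exact add_mem (neg_mem (hB 0 0)) (neg_mem (hB 1 1))

/-! ### Frames that differ by a matrix over a subfield -/

/-- The frames of `p` and `q` differ by an element of `PGL(2, F)`. -/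
def Linked (m : Meridians Γ) (F : IntermediateField ℚ ℂ) (p q : OnePoint ℂ × OnePoint ℂ) : Prop :=
  ∃ A B : PSL(2, ℂ), m.Frame p A ∧ m.Frame q B ∧ B * A⁻¹ ∈ scaledOver F

variable {F : IntermediateField ℚ ℂ}

theorem Linked.symm {p q : OnePoint ℂ × OnePoint ℂ} (h : Linked m F p q) : Linked m F q p := by
  obtain ⟨A, B, hA, hB, h⟩ := h
  refine ⟨B, A, hB, hA, ?_⟩
  have := (scaledOver F).inv_mem h
  rwa [mul_inv_rev, inv_inv] at this

theorem Linked.trans {p q r : OnePoint ℂ × OnePoint ℂ} (h : Linked m F p q)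
    (h' : Linked m F q r) : Linked m F p r := by
  obtain ⟨A, B, hA, hB, h⟩ := h
  obtain ⟨B', C, hB', hC, h'⟩ := h'
  obtain rfl := hB.unique hB'
  refine ⟨A, C, hA, hC, ?_⟩
  have := (scaledOver F).mul_mem h' h
  rwa [mul_assoc, inv_mul_cancel_left] at this

/-- The covering transformation cancels: (B g⁻¹) (A g⁻¹)⁻¹ = B A⁻¹. -/
theorem Linked.smul {p q : OnePoint ℂ × OnePoint ℂ} (hp : IsCusp Γ p.1) (hq : IsCusp Γ q.1)
    (h : Linked m F p q) {g : PSL(2, ℂ)} (hg : g ∈ Γ) : Linked m F (g • p) (g • q) := by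
  obtain ⟨A, B, hA, hB, h⟩ := h
  refine ⟨A * g⁻¹, B * g⁻¹, hA.smul hp hg, hB.smul hq hg, ?_⟩
  convert h using 1
  group

theorem linked_swap {P Q : OnePoint ℂ} (hP : IsCusp Γ P) (hQ : IsCusp Γ Q) (hne : P ≠ Q)
    (hF : ∀ w, m.IsIntercuspParameter P Q w → w ∈ F) : Linked m F (P, Q) (Q, P) := by
  obtain ⟨A, hA⟩ := m.exists_frame hP hne
  obtain ⟨B, hB⟩ := m.exists_frame hQ hne.symm
  obtain ⟨C, hC⟩ := exists_lift (B * A⁻¹)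
  refine ⟨A, B, hA, hB, C, ?_, hC⟩
  have h11 := entry_one_one_eq_zero (m := m) hA.2 hB.1 hC
  have hc := entry_one_zero_ne_zero h11
  have h00 : C 0 0 = 0 := by
    have h : (C : PSL(2, ℂ)) • (OnePoint.infty : OnePoint ℂ) = ((0 : ℂ) : OnePoint ℂ) := by
      rw [hC, mul_smul, inv_smul_eq_iff.2 hA.1.1.symm, hB.2]
    simpa using (smul_infty_eq_coe.1 h).2
  have hw := hF _ ((isIntercuspParameter_iff hA hB.1 hC _).2 rfl)
  have hdet := SL_det C
  -- C interchanges 0 and ∞, so it is antidiagonal. Dividing by c, which need not lie in F, turns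
  -- its entries into w and 1.
  refine ⟨(C 1 0)⁻¹, inv_ne_zero hc, fun i j => ?_⟩
  fin_cases i <;> fin_cases j
  · simp [h00]
  · convert hw using 1
    simp only [h11] at hdet
    field_simp
    change C 1 0 * C 0 1 = -1
    linear_combination -hdet
  · simp [hc]
  · simp [h11]

theorem linked_of_translation {Q P R : OnePoint ℂ} (hP : IsCusp Γ P) (hneQ : P ≠ Q)
    (hneR : P ≠ R) (hF : ∀ u, m.IsTranslationParameter Q P R u → u ∈ F) :
    Linked m F (P, Q) (P, R) := by
  obtain ⟨A, hA⟩ := m.exists_frame hP hneQ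
  obtain ⟨z, hz⟩ := Meridians.exists_positions_coe (m := m) hA.1 hneR
  have hu := hF _ ((isTranslationParameter_iff hP hneQ hneR hA.1 hA.2 hz z).2 (sub_zero z).symm)
  refine ⟨A, _, hA, hA.1.frame hz, ?_⟩
  rw [mul_inv_cancel_right]
  refine ⟨translation (-z), ⟨1, one_ne_zero, fun i j => ?_⟩, rfl⟩
  fin_cases i <;> fin_cases j <;> simp [translation, hu]

/-! ### Connectedness of locally finite unions -/

/-- A property that is passed on between members of a locally finite family of closed sets that
meet holds for all members, if it holds for one, provided that the union is connected. -/
theorem forall_of_isPreconnected_iUnion {X I : Type*} [TopologicalSpace X] {K : I → Set X}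
    (hlf : LocallyFinite K) (hcl : ∀ i, IsClosed (K i)) (hne : ∀ i, (K i).Nonempty)
    (hconn : IsPreconnected (⋃ i, K i)) (p : I → Prop)
    (hp : ∀ i j, (K i ∩ K j).Nonempty → p i → p j) {i₀ : I} (h₀ : p i₀) (i : I) : p i := by
  by_contra hi
  -- Local finiteness makes the unions over the members with and without the property closed. By
  -- connectedness they share a point, where the property passes across.
  have hclosed : ∀ q : I → Prop, IsClosed (⋃ i : {i // q i}, K i) := fun q =>
    (hlf.comp_injective Subtype.val_injective).isClosed_iUnion fun i => hcl i
  have hsub : (⋃ i, K i) ⊆ (⋃ i : {i // p i}, K i) ∪ ⋃ i : {i // ¬ p i}, K i := by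
    refine Set.iUnion_subset fun j => ?_
    by_cases hj : p j
    · exact (Set.subset_iUnion (fun i : {i // p i} => K i) ⟨j, hj⟩).trans Set.subset_union_left
    · exact (Set.subset_iUnion (fun i : {i // ¬ p i} => K i) ⟨j, hj⟩).trans Set.subset_union_right
  obtain ⟨x, hx⟩ := hne i₀
  obtain ⟨y, hy⟩ := hne i
  obtain ⟨w, -, hw1, hw2⟩ := isPreconnected_closed_iff.1 hconn _ _ (hclosed p)
    (hclosed fun i => ¬ p i) hsub
    ⟨x, Set.mem_iUnion.2 ⟨i₀, hx⟩, Set.mem_iUnion.2 ⟨⟨i₀, h₀⟩, hx⟩⟩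
    ⟨y, Set.mem_iUnion.2 ⟨i, hy⟩, Set.mem_iUnion.2 ⟨⟨i, hi⟩, hy⟩⟩
  obtain ⟨⟨j, hj⟩, hwj⟩ := Set.mem_iUnion.1 hw1
  obtain ⟨⟨k, hk⟩, hwk⟩ := Set.mem_iUnion.1 hw2
  exact hk (hp j k ⟨w, hwj, hwk⟩ hj)

/-! ### Continuity of the action and local finiteness of translates of compact sets -/

theorem continuous_act (A : SL(2, ℂ)) : Continuous (act A) := by
  have hz : Continuous H3.z := continuous_fst.comp continuous_subtype_val
  have ht : Continuous H3.t := continuous_snd.comp continuous_subtype_val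
  have hden : Continuous (den A) := by
    unfold den
    exact (Complex.continuous_normSq.comp (by fun_prop)).add (by fun_prop)
  have hnum : Continuous (num A) := by
    unfold num
    fun_prop
  refine Continuous.subtype_mk (Continuous.prodMk ?_ ?_) _
  · exact hnum.div (Complex.continuous_ofReal.comp hden)
      fun x => by exact_mod_cast (den_pos A x).ne'
  · exact ht.div hden fun x => (den_pos A x).ne'

theorem continuous_smul_H3 (g : PSL(2, ℂ)) : Continuous fun x : H3 => g • x := by
  obtain ⟨A, rfl⟩ := exists_lift g
  exact continuous_act A

instance : LocallyCompactSpace H3 :=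
  (isOpen_lt continuous_const continuous_snd).locallyCompactSpace

theorem locallyFinite_smul {E : Type*} [Finite E] (hΓ : ProperlyDiscontinuousSMul Γ H3)
    {K : E → Set H3} (hK : ∀ e, IsCompact (K e)) :
    LocallyFinite fun i : Γ × E => (fun x : H3 => i.1 • x) '' K i.2 := by
  intro x
  obtain ⟨L, hL, hx⟩ := exists_compact_mem_nhds x
  refine ⟨L, hx, ?_⟩
  refine (Set.finite_iUnion fun e => (hΓ.finite_disjoint_inter_image (hK e) hL).prod
    (Set.finite_singleton e)).subset ?_
  rintro ⟨g, e⟩ hge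
  exact Set.mem_iUnion.2 ⟨e, hge, rfl⟩

/-! ### The field generated by the parameters -/

variable {ι κ : Type*}

/-- The pairs of centres corresponding to the initial points of the arcs. -/
def startPair (a : ι → IntercuspArc m) (c : κ → CuspArc m) : ι ⊕ κ → OnePoint ℂ × OnePoint ℂ :=
  Sum.elim (fun i => ((a i).P, (a i).Q)) (fun j => ((c j).P, (c j).Q))

/-- The pairs of centres corresponding to the final points of the arcs. -/
def endPair (a : ι → IntercuspArc m) (c : κ → CuspArc m) : ι ⊕ κ → OnePoint ℂ × OnePoint ℂ :=
  Sum.elim (fun i => ((a i).Q, (a i).P)) (fun j => ((c j).P, (c j).R))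

variable (a : ι → IntercuspArc m) (c : κ → CuspArc m)

theorem isCusp_startPair (e : ι ⊕ κ) : IsCusp Γ (startPair a c e).1 := by
  rcases e with i | j
  exacts [(a i).cuspP, (c j).cuspP]

theorem isCusp_endPair (e : ι ⊕ κ) : IsCusp Γ (endPair a c e).1 := by
  rcases e with i | j
  exacts [(a i).cuspQ, (c j).cuspP]

theorem arcs_zero_mem (e : ι ⊕ κ) : arcs a c e 0 ∈ m.foot (startPair a c e) := by
  rcases e with i | j
  exacts [(a i).source, (c j).source]

theorem arcs_one_mem (e : ι ⊕ κ) : arcs a c e 1 ∈ m.foot (endPair a c e) := by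
  rcases e with i | j
  exacts [(a i).target, (c j).target]

theorem smul_startPair_mem {g : PSL(2, ℂ)} (hg : g ∈ Γ) (e : ι ⊕ κ) :
    g • startPair a c e ∈ liftedEnds a c := by
  rcases e with i | j
  exacts [⟨g, hg, .inl ⟨i, .inl rfl⟩⟩, ⟨g, hg, .inr ⟨j, .inl rfl⟩⟩]

theorem smul_endPair_mem {g : PSL(2, ℂ)} (hg : g ∈ Γ) (e : ι ⊕ κ) :
    g • endPair a c e ∈ liftedEnds a c := by
  rcases e with i | j
  exacts [⟨g, hg, .inl ⟨i, .inr rfl⟩⟩, ⟨g, hg, .inr ⟨j, .inr rfl⟩⟩]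

/-- The field generated by the parameters. -/
abbrev parameterField : IntermediateField ℚ ℂ := IntermediateField.adjoin ℚ (parameters a c)

theorem linked_intercusp (i : ι) :
    Linked m (parameterField a c) ((a i).P, (a i).Q) ((a i).Q, (a i).P) :=
  linked_swap (a i).cuspP (a i).cuspQ (a i).ne fun _ hw =>
    IntermediateField.subset_adjoin ℚ _ (.inl ⟨i, hw⟩)

theorem linked_startPair_endPair (e : ι ⊕ κ) :
    Linked m (parameterField a c) (startPair a c e) (endPair a c e) := by
  rcases e with i | j
  · exact linked_intercusp a c i
  · exact linked_of_translation (c j).cuspP (c j).neQ (c j).neR fun _ hu =>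
      IntermediateField.subset_adjoin ℚ _ (.inr ⟨j, hu⟩)

/-- Reflexivity of `Linked` at p requires a frame of p, so it is obtained by going along the arc and
back. -/
theorem linked_startPair_self (e : ι ⊕ κ) :
    Linked m (parameterField a c) (startPair a c e) (startPair a c e) :=
  (linked_startPair_endPair a c e).trans (linked_startPair_endPair a c e).symm

variable {a c}

/-- A common foot of different pairs occurs only at a touching point; the zero length intercusp arc
there belongs to the collection, so its parameter lies in the field. -/
theorem linked_of_foot_inter (htouch : ContainsTouchingArcs a c)
    {p q : OnePoint ℂ × OnePoint ℂ} (hp : p ∈ liftedEnds a c) (hq : q ∈ liftedEnds a c)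
    (hself : Linked m (parameterField a c) p p)
    (h : (m.foot p ∩ m.foot q).Nonempty) : Linked m (parameterField a c) p q := by
  by_cases hpq : p = q
  · rwa [← hpq]
  · obtain ⟨rfl, g, hg, i, rfl | rfl⟩ := htouch p hp q hq h hpq
    · exact (linked_intercusp a c i).smul (a i).cuspP (a i).cuspQ hg
    · exact (linked_intercusp a c i).symm.smul (a i).cuspQ (a i).cuspP hg

/-- An end of a lifted arc is a foot of a lifted end linked to the initial pair of the arc. -/
theorem exists_linked_of_mem_endPoints {g : PSL(2, ℂ)} (hg : g ∈ Γ) {e : ι ⊕ κ} {x : H3}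
    (hx : x ∈ endPoints (arcs a c e)) : ∃ p ∈ liftedEnds a c, g • x ∈ m.foot p ∧
      Linked m (parameterField a c) (g • startPair a c e) p := by
  rcases hx with rfl | rfl
  · exact ⟨_, smul_startPair_mem a c hg e, smul_foot (isCusp_startPair a c e) hg
      (arcs_zero_mem a c e), (linked_startPair_self a c e).smul (isCusp_startPair a c e)
      (isCusp_startPair a c e) hg⟩
  · exact ⟨_, smul_endPair_mem a c hg e, smul_foot (isCusp_endPair a c e) hg
      (arcs_one_mem a c e), (linked_startPair_endPair a c e).smul (isCusp_startPair a c e)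
      (isCusp_endPair a c e) hg⟩

/-- Lifts meeting at the same parameter of the same arc coincide because Γ acts freely. Otherwise
they meet in ends, and each start is linked to the pair of its end there. -/
theorem linked_of_meet (hfree : ∀ g ∈ Γ, ∀ x : H3, g • x = x → g = 1)
    (hemb : AreEmbeddedUpToEnds a c) (htouch : ContainsTouchingArcs a c) {g h : PSL(2, ℂ)}
    (hg : g ∈ Γ) (hh : h ∈ Γ) {e f : ι ⊕ κ} {s t : unitInterval}
    (hst : g • arcs a c e s = h • arcs a c f t) :
    Linked m (parameterField a c) (g • startPair a c e) (h • startPair a c f) := by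
  have hproj : proj Γ (arcs a c e s) = proj Γ (arcs a c f t) := by
    refine Quotient.sound ⟨⟨g⁻¹ * h, Γ.mul_mem (Γ.inv_mem hg) hh⟩, ?_⟩
    change (g⁻¹ * h) • arcs a c f t = arcs a c e s
    rw [mul_smul, ← hst, inv_smul_smul]
  rcases hemb e f s t hproj with ⟨rfl, rfl⟩ | ⟨hs, ht⟩
  · have h1 : h⁻¹ * g = 1 := by
      refine hfree _ (Γ.mul_mem (Γ.inv_mem hh) hg) (arcs a c e s) ?_
      rw [mul_smul, hst, inv_smul_smul]
    obtain rfl : h = g := inv_mul_eq_one.1 h1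
    exact (linked_startPair_self a c e).smul (isCusp_startPair a c e)
      (isCusp_startPair a c e) hg
  · obtain ⟨p, hp, hxp, hlp⟩ := exists_linked_of_mem_endPoints hg hs
    obtain ⟨q, hq, hxq, hlq⟩ := exists_linked_of_mem_endPoints hh ht
    rw [← hst] at hxq
    exact (hlp.trans (linked_of_foot_inter htouch hp hq (hlp.symm.trans hlp) ⟨_, hxp, hxq⟩)).trans
      hlq.symm

theorem preimage_arcUnion : proj Γ ⁻¹' arcUnion a c =
    ⋃ i : Γ × (ι ⊕ κ), (fun x : H3 => i.1 • x) '' Set.range (arcs a c i.2) := by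
  ext x
  simp only [arcUnion, Set.mem_preimage, Set.mem_iUnion, Set.mem_image, Prod.exists]
  constructor
  · rintro ⟨e, y, hy, hyx⟩
    obtain ⟨g, hg⟩ := Quotient.exact hyx
    refine ⟨g⁻¹, e, y, hy, ?_⟩
    rw [← hg]
    exact inv_smul_smul g x
  · rintro ⟨g, e, y, hy, rfl⟩
    exact ⟨e, y, hy, Quotient.sound ⟨g⁻¹, inv_smul_smul g y⟩⟩

theorem invariantTraceField_le_parameterField [Finite ι] [Finite κ]
    (hfree : ∀ g ∈ Γ, ∀ x : H3, g • x = x → g = 1) (hpd : ProperlyDiscontinuousSMul Γ H3)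
    (hemb : AreEmbeddedUpToEnds a c) (htouch : ContainsTouchingArcs a c)
    (hconn : IsConnected (proj Γ ⁻¹' arcUnion a c)) :
    invariantTraceField Γ ≤ parameterField a c := by
  rw [preimage_arcUnion] at hconn
  obtain ⟨x, hx⟩ := hconn.nonempty
  -- Nonemptiness of the preimage supplies an arc, whose initial pair serves as base point.
  obtain ⟨⟨g₀, e⟩, -⟩ := Set.mem_iUnion.1 hx
  have hcomp : ∀ f, IsCompact (Set.range (arcs a c f)) := fun f =>
    isCompact_range (arcs a c f).continuous
  have hall : ∀ i : Γ × (ι ⊕ κ), Linked m (parameterField a c) (startPair a c e)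
      ((i.1 : PSL(2, ℂ)) • startPair a c i.2) := by
    refine forall_of_isPreconnected_iUnion (locallyFinite_smul hpd hcomp)
      (fun i => ((hcomp i.2).image (continuous_smul_H3 i.1)).isClosed)
      (fun i => (Set.range_nonempty _).image _) hconn.isPreconnected _ ?_ (i₀ := (1, e)) ?_
    · rintro ⟨g, e'⟩ ⟨h, f⟩ ⟨_, ⟨_, ⟨s, rfl⟩, rfl⟩, ⟨_, ⟨t, rfl⟩, hst⟩⟩ hl
      exact hl.trans (linked_of_meet hfree hemb htouch g.2 h.2 hst.symm)
    · simpa using linked_startPair_self a c e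
  obtain ⟨A, -, hA, -, -⟩ := linked_startPair_self a c e
  refine invariantTraceField_le A fun g hg => ?_
  -- The translate by g⁻¹ is used because its frame is A g, so that the change of frames is A g A⁻¹.
  obtain ⟨A', B, hA', hB, h⟩ := hall (⟨g⁻¹, Γ.inv_mem hg⟩, e)
  obtain rfl := hA.unique hA'
  obtain rfl := hB.unique (hA.smul (isCusp_startPair a c e) (Γ.inv_mem hg))
  simpa using h

end HypThree

end

open HypThree in
theorem theorem4 (Γ : Subgroup PSL(2, ℂ)) (hΓ : IsFiniteVolumeManifoldGroup Γ)
    (m : Meridians Γ) {ι κ : Type*} [Finite ι] [Finite κ]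
    (a : ι → IntercuspArc m) (c : κ → CuspArc m)
    (hemb : AreEmbeddedUpToEnds a c) (htouch : ContainsTouchingArcs a c)
    (hconn : IsConnected (proj Γ ⁻¹' arcUnion a c)) :
    IntermediateField.adjoin ℚ (parameters a c) = invariantTraceField Γ := by
  apply le_antisymm
  · rw [IntermediateField.adjoin_le_iff]
    rintro x (⟨i, hw⟩ | ⟨j, hu⟩)
    · exact intercuspParameter_mem (a i).cuspP (a i).cuspQ (a i).ne hw
    · exact translationParameter_mem (c j).cuspQ (c j).cuspP (c j).cuspR (c j).neQ (c j).neR hu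
  · exact invariantTraceField_le_parameterField hΓ.free hΓ.properlyDiscontinuous hemb htouch hconn
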